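/- Let $G=\prod_{j=0}^{\infty} \mathbb{Z}_2$ be the dyadic (Walsh) group with normalized Haar measure $\mu$, let $I_m(x)=\{y\in G: y_j=x_j \text{ for } 0\le j<m\}$, and let $\zeta_m$ be the $\sigma$-algebra generated by the intervals $I_m(x)$, $x\in G$. For $0<p<\infty$ the Hardy space $H_p(G)$ consists of all (real or complex) martingales $F=(F_m)_{m\in\mathbb{N}}$ with respect to $(\zeta_m)_{m\in\mathbb{N}}$ such that $\|F\|_{H_p}:=\|\sup_{m}|F_m|\|_{L_p(G)}<\infty$. Let $(w_j)_{j\ge 0}$ be the Walsh system, $w_j(x)=\prod_{i}(-1)^{j_i x_i}$ for $j=\sum_i j_i2^i$, $j_i\in\{0,1\}$. For a martingale $F$ put $\widehat F(j)=\lim_{m\to\infty}\int_G F_m w_j\,d\mu$, $S_mF=\sum_{j=0}^{m-1}\widehat F(j)w_j$ and $\sigma_mF=\frac1m\sum_{j=1}^m S_jF$ ($m\ge1$). For $0\le k\le s-1$ let $$\beta_k^s=2^s+2^{s-1}+\dots+2^k .$$ Let $n\ge 1$ be an integer. Then the restricted weighted maximal operator $$\tilde\sigma_7^{*,\nabla}F:=\sup_{s\ge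 1}\ \sup_{\max(0,\,s-[s^{1/n}]-1)\le k\le s-1}\frac{|\sigma_{\beta_k^s}F|}{\log^{2/n}\beta_k^s},$$ where $[\cdot]$ denotes the integer part, is bounded from the Hardy space $H_{1/2}(G)$ to the Lebesgue space $L_{1/2}(G)$: there is a constant $C$, depending only on $n$, such that $\tilde\sigma_7^{*,\nabla}F\in L_{1/2}(G)$ and $\|\tilde\sigma_7^{*,\nabla}F\|_{1/2}\le C\|F\|_{H_{1/2}}$ for every $F\in H_{1/2}(G)$. In particular ($n=2$), this holds for the indices $s-[\sqrt s]-1\le k\le s-1$ and the weight $\log\beta_k^s$. -/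

import Mathlib

open MeasureTheory Filter
open scoped ENNReal NNReal

namespace WalshFejer

/-- The Walsh (dyadic) group: the complete direct product of countably many copies of `Z_2`. -/
abbrev G : Type := ℕ → ZMod 2

/-- The normalized Haar measure on `G`: the product of the measures on `Z_2` for which each
singleton has measure `1/2`. -/
noncomputable def haar : Measure G :=
  Measure.infinitePi fun _ : ℕ => (PMF.uniformOfFintype (ZMod 2)).toMeasure

/-- The dyadic interval `I_n(x)`. -/
def interval (n : ℕ) (x : G) : Set G := {y | ∀ j < n, y j = x j}

theorem measurableSet_interval (n : ℕ) (x : G) : MeasurableSet (interval n x) := by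
  have h : interval n x = ⋂ j ∈ Finset.range n, (fun y : G => y j) ⁻¹' {x j} := by
    ext y; simp [interval]
  rw [h]
  exact Finset.measurableSet_biInter _ fun j _ =>
    measurable_pi_apply j (MeasurableSet.singleton (x j))

/-- Each interval of rank `n` is the union of two intervals of rank `n + 1`. -/
theorem interval_eq_union (n : ℕ) (x : G) :
    interval n x =
      interval (n + 1) (Function.update x n 0) ∪ interval (n + 1) (Function.update x n 1) := by
  have two : ∀ a : ZMod 2, a = 0 ∨ a = 1 := by decide
  ext y
  simp only [interval, Set.mem_ofPred_eq, Set.mem_union]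
  constructor
  · intro h
    refine (two (y n)).imp (fun hy j hj => ?_) (fun hy j hj => ?_) <;>
    · rcases Nat.lt_succ_iff_lt_or_eq.mp hj with hj | rfl
      · rw [Function.update_of_ne hj.ne]; exact h j hj
      · rw [Function.update_self]; exact hy
  · rintro (h | h) j hj <;>
    · have := h j (by omega)
      rwa [Function.update_of_ne hj.ne] at this

/-- The dyadic filtration: `ζ_n` is the σ-algebra generated by the intervals `I_n(x)`, `x ∈ G`. -/
def dyadicFiltration : Filtration ℕ (inferInstance : MeasurableSpace G) where
  seq n := MeasurableSpace.generateFrom (Set.range (interval n))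
  mono' := by
    refine monotone_nat_of_le_succ fun n => MeasurableSpace.generateFrom_le ?_
    rintro _ ⟨x, rfl⟩
    rw [interval_eq_union]
    exact MeasurableSet.union (MeasurableSpace.measurableSet_generateFrom ⟨_, rfl⟩)
      (MeasurableSpace.measurableSet_generateFrom ⟨_, rfl⟩)
  le' n := by
    refine MeasurableSpace.generateFrom_le ?_
    rintro _ ⟨x, rfl⟩
    exact measurableSet_interval n x

/-- The `k`-th Rademacher function `r_k(x) = (-1)^{x_k}`. -/
def rademacher (k : ℕ) (x : G) : ℝ := (-1) ^ (x k).val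

/-- The `n`-th Walsh function `w_n = ∏_k r_k^{n_k}`, where `n = ∑_k n_k 2^k` is the binary
expansion of `n` (all binary digits with index at least `Nat.size n` vanish). -/
def walsh (n : ℕ) (x : G) : ℝ :=
  ∏ k ∈ Finset.range (Nat.size n), rademacher k x ^ (n.testBit k).toNat

section Martingales

variable {𝕜 : Type*} [RCLike 𝕜]

/-- The maximal function `F^* = sup_n |F_n|`. -/
noncomputable def maximalFunction (F : ℕ → G → 𝕜) (x : G) : ℝ≥0∞ := ⨆ n, ‖F n x‖ₑ

/-- The (quasi-)norm `‖F‖_{H_p} = ‖F^*‖_p`. -/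
noncomputable def hardyNorm (p : ℝ≥0∞) (F : ℕ → G → 𝕜) : ℝ≥0∞ :=
  eLpNorm (maximalFunction F) p haar

/-- `F` belongs to the martingale Hardy space `H_p(G)`: it is a martingale with respect to the
dyadic filtration, and `‖F‖_{H_p} < ∞`. -/
def MemHardy (p : ℝ≥0∞) (F : ℕ → G → 𝕜) : Prop :=
  Martingale F dyadicFiltration haar ∧ hardyNorm p F < ∞

/-- The `k`-th Walsh–Fourier coefficient of a martingale, `lim_n ∫ F_n w_k` (for a martingale the
sequence is eventually constant, so that the limit exists). -/
noncomputable def fourierCoeff (F : ℕ → G → 𝕜) (k : ℕ) : 𝕜 :=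
  limUnder atTop fun n : ℕ => ∫ x, F n x * (walsh k x : 𝕜) ∂haar

/-- The partial sum `S_n F = ∑_{k < n} F̂(k) w_k`. -/
noncomputable def partialSum (F : ℕ → G → 𝕜) (n : ℕ) (x : G) : 𝕜 :=
  ∑ k ∈ Finset.range n, fourierCoeff F k * (walsh k x : 𝕜)

/-- The Fejér mean `σ_n F = (1/n) ∑_{k=1}^n S_k F` (used for `n ≥ 1`). -/
noncomputable def fejerMean (F : ℕ → G → 𝕜) (n : ℕ) (x : G) : 𝕜 :=
  (n : 𝕜)⁻¹ * ∑ k ∈ Finset.Icc 1 n, partialSum F k x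

/-- `β_k^s = 2^s + 2^{s-1} + ⋯ + 2^k`. -/
def beta (s k : ℕ) : ℕ := ∑ j ∈ Finset.Icc k s, 2 ^ j

/-- The integer part of the `n`-th root of `s`. -/
noncomputable def rootFloor (n s : ℕ) : ℕ := ⌊(s : ℝ) ^ (1 / (n : ℝ))⌋₊

/-- The restricted weighted maximal operator
`sup_s sup_k |σ_{β_k^s} F| / log^{2/n} β_k^s`, the inner supremum being over the indices
`0 ≤ k` with `s - [s^{1/n}] - 1 ≤ k ≤ s - 1`. (Such indices exist only for `s ≥ 1`, and then
`β_k^s ≥ 3`, so that the weights are positive.) -/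
noncomputable def restrictedMaximal (n : ℕ) (F : ℕ → G → 𝕜) (x : G) : ℝ≥0∞ :=
  ⨆ (s : ℕ) (k : ℕ) (_ : k + 1 ≤ s ∧ s ≤ k + rootFloor n s + 1),
    ‖fejerMean F (beta s k) x‖ₑ / ENNReal.ofReal (Real.log (beta s k : ℝ) ^ (2 / (n : ℝ)))

end Martingales

end WalshFejer

/-! Everything is estimated after taking square roots. Peeling binary blocks off `β_k^s` bounds the
Fejér kernel by `2^{-s} ∑_{j=k}^s ∑_{t≤j} 2^{t+j+1} 1_{I_j(e_t)}` (`abs_fejerSum_beta_le`). Since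
`β_k^s < 2^{s+1}`, the mean is a convolution of `F_{s+1}` with this kernel. The integrand is
constant on intervals of measure `2^{-(s+1)}`, so the square root may enter the integral at the cost
of `2^{(s+1)/2}` (`lintegral_rpow_half_le`). The powers of two balance, leaving `2 ∑_{j=k}^s
W_j(|F_{s+1}|^{1/2})`, where `W_j` is `weightedAverage j`, bounded on `L_1` uniformly in `j`. The
sum has at most `ρ(s) = [s^{1/n}] + 2` terms, and the square root of the weight is at least
`ρ(s)/6`.

It remains to make the supremum over `s` integrable. Bound `|F_{s+1}|^{1/2}` by `∑_{l≤s+1} d_l`, the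
increments of its running maximum: `d_l ≥ 0` depends on the first `l` coordinates, and `∑ d_l ≤
(F^*)^{1/2}`. For fixed `l`, `ρ(s)⁻¹ ∑_{j=k}^s W_j d_l` has a majorant free of `s`
(`inv_mul_sum_weightedAverage_le`): ranks `j ≥ l` cost a multiple of `d_l` plus a geometric tail,
and ranks `j < l` lie in a fixed window of length at most `ρ(l-1)`, because `s - ρ(s)` is
nondecreasing. The majorant has integral at most `C ∫ d_l` with `C` absolute; summation over `l`
concludes. -/

namespace WalshFejer

/-! ### Walsh functions and pointwise bounds for the Fejér kernels -/

section Kernel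

theorem mem_interval {n : ℕ} {x y : G} : y ∈ interval n x ↔ ∀ j < n, y j = x j := Iff.rfl

theorem mem_interval_add_iff {n : ℕ} (x y z : G) :
    x + y ∈ interval n z ↔ y ∈ interval n (x + z) := by
  simp only [mem_interval, Pi.add_apply]
  refine forall₂_congr fun j _ => ?_
  generalize x j = a; generalize y j = b; generalize z j = c
  revert a b c; decide

theorem rademacher_add (k : ℕ) (x y : G) :
    rademacher k (x + y) = rademacher k x * rademacher k y := by
  simp only [rademacher, Pi.add_apply]
  have two : ∀ a : ZMod 2, a = 0 ∨ a = 1 := by decide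
  have h11 : (1 + 1 : ZMod 2) = 0 := by decide
  rcases two (x k) with h | h <;> rcases two (y k) with h' | h' <;>
    simp [h, h', h11, ZMod.val_one]

theorem abs_rademacher (k : ℕ) (x : G) : |rademacher k x| = 1 := by
  simp [rademacher, abs_pow]

theorem one_add_rademacher (k : ℕ) (x : G) :
    1 + rademacher k x = if x k = 0 then 2 else 0 := by
  have two : ∀ a : ZMod 2, a = 0 ∨ a = 1 := by decide
  rcases two (x k) with h | h <;> norm_num [rademacher, h, ZMod.val_one]

theorem measurable_rademacher (k : ℕ) : Measurable (rademacher k) :=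
  (measurable_from_top (f := fun a : ZMod 2 => (-1 : ℝ) ^ a.val)).comp (measurable_pi_apply k)

theorem walsh_eq_prod {n m : ℕ} (h : n < 2 ^ m) (x : G) :
    walsh n x = ∏ k ∈ Finset.range m, rademacher k x ^ (n.testBit k).toNat := by
  refine Finset.prod_subset (by simpa using Nat.size_le.2 h) fun k _ hk => ?_
  have : n < 2 ^ k := Nat.size_le.1 (by simpa using hk)
  simp [Nat.testBit_eq_false_of_lt this]

theorem walsh_zero (x : G) : walsh 0 x = 1 := by simp [walsh]

theorem walsh_add (n : ℕ) (x y : G) : walsh n (x + y) = walsh n x * walsh n y := by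
  simp only [walsh, rademacher_add, mul_pow, Finset.prod_mul_distrib]

theorem abs_walsh (n : ℕ) (x : G) : |walsh n x| = 1 := by
  simp [walsh, Finset.abs_prod, abs_pow, abs_rademacher]

theorem measurable_walsh (n : ℕ) : Measurable (walsh n) :=
  Finset.measurable_prod _ fun k _ => (measurable_rademacher k).pow_const _

theorem walsh_congr {n m : ℕ} (h : n < 2 ^ m) {x y : G} (hxy : y ∈ interval m x) :
    walsh n y = walsh n x := by
  rw [walsh_eq_prod h, walsh_eq_prod h]
  refine Finset.prod_congr rfl fun k hk => ?_
  rw [rademacher, rademacher, hxy k (by simpa using hk)]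

theorem walsh_two_pow_add {i j : ℕ} (h : i < 2 ^ j) (x : G) :
    walsh (2 ^ j + i) x = rademacher j x * walsh i x := by
  rw [walsh_eq_prod (m := j + 1) (by rw [pow_succ]; omega), Finset.prod_range_succ,
    walsh_eq_prod h, mul_comm]
  congr 1
  · simp [Nat.testBit_two_pow_add_eq, Nat.testBit_eq_false_of_lt h]
  · refine Finset.prod_congr rfl fun k hk => ?_
    rw [Nat.testBit_two_pow_add_gt (by simpa using hk)]

/-- The Walsh–Dirichlet kernel. -/
noncomputable def dirichlet (m : ℕ) (x : G) : ℝ := ∑ i ∈ Finset.range m, walsh i x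

/-- The unnormalised Walsh–Fejér kernel `∑_{m=1}^M D_m`. -/
noncomputable def fejerSum (M : ℕ) (x : G) : ℝ := ∑ m ∈ Finset.range M, dirichlet (m + 1) x

theorem dirichlet_two_pow_add {m j : ℕ} (h : m ≤ 2 ^ j) (x : G) :
    dirichlet (2 ^ j + m) x = dirichlet (2 ^ j) x + rademacher j x * dirichlet m x := by
  rw [dirichlet, Finset.sum_range_add, dirichlet, dirichlet, Finset.mul_sum]
  congr 1
  refine Finset.sum_congr rfl fun i hi => walsh_two_pow_add ?_ x
  have := Finset.mem_range.1 hi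
  omega

theorem fejerSum_two_pow_add {m j : ℕ} (h : m ≤ 2 ^ j) (x : G) :
    fejerSum (2 ^ j + m) x =
      fejerSum (2 ^ j) x + (m * dirichlet (2 ^ j) x + rademacher j x * fejerSum m x) := by
  rw [fejerSum, Finset.sum_range_add, fejerSum, fejerSum, Finset.mul_sum]
  congr 1
  have (i : ℕ) (hi : i ∈ Finset.range m) : dirichlet (2 ^ j + i + 1) x =
      dirichlet (2 ^ j) x + rademacher j x * dirichlet (i + 1) x := by
    have := Finset.mem_range.1 hi
    rw [add_assoc, dirichlet_two_pow_add (by omega)]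
  rw [Finset.sum_congr rfl this, Finset.sum_add_distrib]
  simp

/-- The point of `G` whose only nonzero coordinate has index `t`. -/
def basisPoint (t : ℕ) : G := Pi.single t 1

/-- The indicator of the interval of rank `j` around `e_t`, which is `I_j(0)` if `j ≤ t`. -/
noncomputable def bump (j t : ℕ) (x : G) : ℝ := (interval j (basisPoint t)).indicator 1 x

theorem bump_nonneg (j t : ℕ) (x : G) : 0 ≤ bump j t x :=
  Set.indicator_nonneg (fun _ _ => zero_le_one) x

theorem bump_succ_of_ne {j t : ℕ} (h : t ≠ j) (x : G) :
    bump (j + 1) t x = (if x j = 0 then 1 else 0) * bump j t x := by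
  classical
  have : basisPoint t j = 0 := Pi.single_eq_of_ne h.symm _
  have key : x ∈ interval (j + 1) (basisPoint t) ↔ x j = 0 ∧ x ∈ interval j (basisPoint t) := by
    simp only [mem_interval, Nat.lt_succ_iff_lt_or_eq, or_imp, forall_and, forall_eq, this]
    tauto
  simp only [bump, Set.indicator_apply, key]
  split_ifs <;> simp_all

theorem bump_succ_self (j : ℕ) (x : G) :
    bump (j + 1) j x = (if x j = 0 then 0 else 1) * bump j j x := by
  classical
  have : basisPoint j j = 1 := Pi.single_eq_same _ _
  have two : ∀ a : ZMod 2, a = 1 ↔ a ≠ 0 := by decide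
  have key : x ∈ interval (j + 1) (basisPoint j) ↔ x j ≠ 0 ∧ x ∈ interval j (basisPoint j) := by
    simp only [mem_interval, Nat.lt_succ_iff_lt_or_eq, or_imp, forall_and, forall_eq, this, two]
    tauto
  simp only [bump, Set.indicator_apply, key]
  split_ifs <;> simp_all

theorem bump_congr_of_le {j t t' : ℕ} (h : j ≤ t) (h' : j ≤ t') : bump j t = bump j t' := by
  have : interval j (basisPoint t) = interval j (basisPoint t') := by
    ext x
    refine forall₂_congr fun i hi => ?_
    rw [basisPoint, basisPoint, Pi.single_eq_of_ne (by omega), Pi.single_eq_of_ne (by omega)]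
  unfold bump
  rw [this]

theorem dirichlet_two_pow (j : ℕ) (x : G) : dirichlet (2 ^ j) x = 2 ^ j * bump j j x := by
  induction j with
  | zero => simp [dirichlet, walsh_zero, bump, interval]
  | succ j ih =>
    have h1 : bump j (j + 1) x = bump j j x := by
      rw [bump_congr_of_le (Nat.le_succ j) le_rfl]
    rw [pow_succ, mul_two, dirichlet_two_pow_add le_rfl, ih, bump_succ_of_ne (by omega), h1,
      ← one_add_mul, one_add_rademacher]
    split_ifs <;> ring

/-- Induction on `K_{j+1} = (1 + r_j) K_j + 2^j D_{2^j}`, with `K_j` the sum at `2^j`: the factor `1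
+ r_j` doubles the old terms on `x_j = 0` and kills them on `x_j = 1`. -/
theorem fejerSum_two_pow_le (j : ℕ) (x : G) :
    0 ≤ fejerSum (2 ^ j) x ∧
      fejerSum (2 ^ j) x ≤ ∑ t ∈ Finset.range (j + 1), 2 ^ (t + j) * bump j t x := by
  induction j with
  | zero => simp [fejerSum, dirichlet, walsh_zero, bump, interval]
  | succ j ih =>
    have h1 : bump j (j + 1) x = bump j j x := by
      rw [bump_congr_of_le (Nat.le_succ j) le_rfl]
    have hrec : fejerSum (2 ^ (j + 1)) x =
        (if x j = 0 then 2 else 0) * fejerSum (2 ^ j) x + 2 ^ j * (2 ^ j * bump j j x) := by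
      rw [pow_succ, mul_two, fejerSum_two_pow_add le_rfl, dirichlet_two_pow,
        ← one_add_rademacher]
      push_cast
      ring
    have hsum : ∑ t ∈ Finset.range j, 2 ^ (t + (j + 1)) * bump (j + 1) t x =
        (if x j = 0 then 2 else 0) * ∑ t ∈ Finset.range j, 2 ^ (t + j) * bump j t x := by
      rw [Finset.mul_sum]
      refine Finset.sum_congr rfl fun t ht => ?_
      rw [bump_succ_of_ne (Finset.mem_range.1 ht).ne]
      split_ifs <;> ring
    have hb := bump_nonneg j j x
    have hp : (0 : ℝ) ≤ 2 ^ j * (2 ^ j * bump j j x) := by positivity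
    rw [Finset.sum_range_succ] at ih
    rw [hrec, Finset.sum_range_succ, Finset.sum_range_succ, hsum, bump_succ_self,
      bump_succ_of_ne (by omega : j + 1 ≠ j), h1]
    have e1 : (2 : ℝ) ^ (j + (j + 1)) = 2 * (2 ^ j * 2 ^ j) := by ring
    have e2 : (2 : ℝ) ^ (j + 1 + (j + 1)) = 4 * (2 ^ j * 2 ^ j) := by ring
    rw [pow_add] at ih
    rw [e1, e2]
    -- On `x_j = 0` the diagonal terms total at most `(2 + 1)·4^j`, absorbed by the coefficient
    -- `4·4^j` at `t = j + 1`. On `x_j = 1` only the new `4^j` survives, absorbed by `2·4^j` at `t =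
    -- j`.
    split_ifs
    · constructor <;> nlinarith [ih.1, ih.2]
    · constructor <;> nlinarith [ih.1, ih.2]

theorem beta_self (k : ℕ) : beta k k = 2 ^ k := by simp [beta]

theorem beta_succ {s k : ℕ} (h : k ≤ s + 1) : beta (s + 1) k = 2 ^ (s + 1) + beta s k := by
  rw [beta, beta, Finset.sum_Icc_succ_top h, add_comm]

theorem beta_lt (s k : ℕ) : beta s k < 2 ^ (s + 1) := by
  calc beta s k ≤ ∑ j ∈ Finset.range (s + 1), 2 ^ j := by
        refine Finset.sum_le_sum_of_subset fun j hj => ?_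
        simp only [Finset.mem_Icc, Finset.mem_range] at *
        omega
    _ < 2 ^ (s + 1) := Nat.geomSum_lt le_rfl (by simp)

theorem two_pow_le_beta {s k : ℕ} (h : k ≤ s) : 2 ^ s ≤ beta s k :=
  Finset.single_le_sum (f := fun j => 2 ^ j) (by simp) (Finset.mem_Icc.2 ⟨h, le_rfl⟩)

/-- The Dirichlet term equals the `t = j` summand of the bound on the Fejér sum, so doubling that
bound covers both. -/
theorem two_pow_block_le (j : ℕ) (x : G) :
    fejerSum (2 ^ j) x + 2 ^ j * dirichlet (2 ^ j) x ≤
      ∑ t ∈ Finset.range (j + 1), 2 ^ (t + j + 1) * bump j t x := by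
  have h := (fejerSum_two_pow_le j x).2
  have hs : ∑ t ∈ Finset.range (j + 1), 2 ^ (t + j + 1) * bump j t x =
      2 * ∑ t ∈ Finset.range (j + 1), 2 ^ (t + j) * bump j t x := by
    rw [Finset.mul_sum]
    exact Finset.sum_congr rfl fun t _ => by ring
  have h1 : (2 : ℝ) ^ (j + j) * bump j j x ≤
      ∑ t ∈ Finset.range (j + 1), 2 ^ (t + j) * bump j t x :=
    Finset.single_le_sum (f := fun t => (2 : ℝ) ^ (t + j) * bump j t x)
      (fun t _ => mul_nonneg (by positivity) (bump_nonneg _ _ _)) (by simp)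
  rw [dirichlet_two_pow, hs, ← mul_assoc, ← pow_add]
  linarith

theorem dirichlet_two_pow_nonneg (j : ℕ) (x : G) : 0 ≤ dirichlet (2 ^ j) x := by
  rw [dirichlet_two_pow]
  exact mul_nonneg (by positivity) (bump_nonneg _ _ _)

/-- Removing the leading power of two from `β_k^{s+1}` leaves `β_k^s`, multiplied by a Rademacher
function of modulus one; each block therefore contributes once, without accumulating constants. -/
theorem abs_fejerSum_beta_le {s k : ℕ} (h : k ≤ s) (x : G) :
    |fejerSum (beta s k) x| ≤
      ∑ j ∈ Finset.Icc k s, ∑ t ∈ Finset.range (j + 1), 2 ^ (t + j + 1) * bump j t x := by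
  induction s, h using Nat.le_induction with
  | base =>
    rw [beta_self, abs_of_nonneg (fejerSum_two_pow_le k x).1, Finset.Icc_self,
      Finset.sum_singleton]
    refine le_trans ?_ (two_pow_block_le k x)
    have := dirichlet_two_pow_nonneg k x
    have : 0 ≤ 2 ^ k * dirichlet (2 ^ k) x := by positivity
    linarith
  | succ s hks ih =>
    have hD := dirichlet_two_pow_nonneg (s + 1) x
    have hb : (beta s k : ℝ) ≤ 2 ^ (s + 1) := by exact_mod_cast (beta_lt s k).le
    rw [beta_succ (by omega), fejerSum_two_pow_add (beta_lt s k).le,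
      Finset.sum_Icc_succ_top (by omega)]
    calc _ ≤ |fejerSum (2 ^ (s + 1)) x| + (|beta s k * dirichlet (2 ^ (s + 1)) x| +
          |rademacher (s + 1) x * fejerSum (beta s k) x|) :=
          (abs_add_le _ _).trans (add_le_add_right (abs_add_le _ _) _)
      _ ≤ fejerSum (2 ^ (s + 1)) x + (2 ^ (s + 1) * dirichlet (2 ^ (s + 1)) x +
          |fejerSum (beta s k) x|) := by
          rw [abs_of_nonneg (fejerSum_two_pow_le _ x).1, abs_mul (rademacher _ _),
            abs_rademacher, one_mul, abs_of_nonneg (by positivity)]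
          gcongr
      _ ≤ _ := by linarith [two_pow_block_le (s + 1) x]

theorem fejerSum_congr {M m : ℕ} (h : M ≤ 2 ^ m) {x y : G} (hxy : y ∈ interval m x) :
    fejerSum M y = fejerSum M x := by
  refine Finset.sum_congr rfl fun i hi => Finset.sum_congr rfl fun j hj => walsh_congr ?_ hxy
  simp only [Finset.mem_range] at *
  omega

theorem measurable_fejerSum (M : ℕ) : Measurable (fejerSum M) :=
  Finset.measurable_sum _ fun _ _ => Finset.measurable_sum _ fun _ _ => measurable_walsh _

end Kernel

/-! ### Dyadic intervals, functions of finitely many coordinates, and the square root of an integral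
-/

section Measure

instance : IsProbabilityMeasure haar := by unfold haar; infer_instance

theorem haar_interval (m : ℕ) (x : G) : haar (interval m x) = (2⁻¹ : ℝ≥0∞) ^ m := by
  have h : interval m x = (↑(Finset.range m) : Set ℕ).pi fun j => {x j} := by
    ext y; simp [interval]
  rw [h, haar, Measure.infinitePi_pi _ fun _ _ => MeasurableSet.singleton _]
  simp

/-- A function on `G` depends only on the first `m` coordinates. -/
def DependsOnFirst {α : Type*} (m : ℕ) (f : G → α) : Prop :=
  ∀ ⦃x y : G⦄, y ∈ interval m x → f y = f x

theorem interval_anti {l m : ℕ} (h : l ≤ m) (x : G) : interval m x ⊆ interval l x :=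
  fun _ hy j hj => hy j (hj.trans_le h)

theorem DependsOnFirst.mono {α : Type*} {l m : ℕ} (h : l ≤ m) {f : G → α}
    (hf : DependsOnFirst l f) : DependsOnFirst m f :=
  fun x _ hy => hf (interval_anti h x hy)

theorem DependsOnFirst.comp {α β : Type*} {m : ℕ} {f : G → α} (hf : DependsOnFirst m f)
    (φ : α → β) : DependsOnFirst m fun x => φ (f x) :=
  fun _ _ hy => congrArg φ (hf hy)

theorem mem_iff_of_measurableSet_dyadicFiltration {m : ℕ} {A : Set G}
    (hA : MeasurableSet[dyadicFiltration m] A) :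
    ∀ ⦃x y : G⦄, y ∈ interval m x → (y ∈ A ↔ x ∈ A) := by
  induction A, hA using MeasurableSpace.generateFrom_induction with
  | hC t ht =>
    obtain ⟨z, rfl⟩ := ht
    intro x y hxy
    exact forall₂_congr fun j hj => by rw [hxy j hj]
  | empty => simp
  | compl t _ ih => intro x y hxy; simp [ih hxy]
  | iUnion s _ ih => intro x y hxy; simp [ih _ hxy]

theorem dependsOnFirst_of_measurable {α : Type*} [MeasurableSpace α] [MeasurableSingletonClass α]
    {m : ℕ} {f : G → α} (hf : Measurable[dyadicFiltration m] f) : DependsOnFirst m f := by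
  intro x y hxy
  exact (mem_iff_of_measurableSet_dyadicFiltration
    (hf (MeasurableSet.singleton (f x))) hxy).2 rfl

theorem measurable_eval_dyadicFiltration {k m : ℕ} (h : k < m) :
    Measurable[dyadicFiltration m] fun x : G => x k := by
  classical
  refine @measurable_to_countable' _ _ _ _ (dyadicFiltration m) _ fun a => ?_
  -- Extending `m`-tuples by zero picks one centre for each of the finitely many intervals of rank
  -- `m`, so the union is countable.
  have : (fun x : G => x k) ⁻¹' {a} =
      ⋃ z ∈ Set.range (fun u : Fin m → ZMod 2 => fun i => if h : i < m then u ⟨i, h⟩ else 0) ∩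
        {z : G | z k = a}, interval m z := by
    ext x
    simp only [Set.mem_preimage, Set.mem_singleton_iff, Set.mem_iUnion, exists_prop]
    constructor
    · intro hx
      refine ⟨_, ⟨⟨fun i => x i, rfl⟩, ?_⟩, fun j hj => ?_⟩
      · simpa [h] using hx
      · simp [hj]
    · rintro ⟨z, ⟨_, hz⟩, hxz⟩
      exact (hxz k h).trans hz
  rw [this]
  refine MeasurableSet.biUnion ((Set.finite_range _).inter_of_left _).countable fun z _ => ?_
  exact MeasurableSpace.measurableSet_generateFrom ⟨z, rfl⟩

/-- A function constant on intervals of measure `2^{-m}` satisfies `sup h^{1/2} ≤ 2^m ∫ h^{1/2}`;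
then `∫ h ≤ sup h^{1/2} · ∫ h^{1/2}`. This replaces the missing `L_1` control of the martingale. -/
theorem lintegral_rpow_half_le {m : ℕ} {h : G → ℝ≥0∞} (hd : DependsOnFirst m h)
    (hm : Measurable h) :
    (∫⁻ y, h y ∂haar) ^ (1 / 2 : ℝ) ≤ 2 ^ (m / 2 : ℝ) * ∫⁻ y, h y ^ (1 / 2 : ℝ) ∂haar := by
  set J := ∫⁻ y, h y ^ (1 / 2 : ℝ) ∂haar with hJ
  have hsup : ∀ x, h x ^ (1 / 2 : ℝ) ≤ 2 ^ m * J := by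
    intro x
    calc h x ^ (1 / 2 : ℝ) = 2 ^ m * (h x ^ (1 / 2 : ℝ) * haar (interval m x)) := by
          rw [haar_interval, mul_left_comm, ← mul_pow, ENNReal.mul_inv_cancel (by simp) (by simp)]
          simp
      _ = 2 ^ m * ∫⁻ y in interval m x, h y ^ (1 / 2 : ℝ) ∂haar := by
          rw [← setLIntegral_const]
          congr 1
          exact setLIntegral_congr_fun (measurableSet_interval m x) fun y hy => by rw [hd hy]
      _ ≤ 2 ^ m * J := by gcongr; exact setLIntegral_le_lintegral _ _
  have hint : ∫⁻ y, h y ∂haar ≤ 2 ^ m * J * J := by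
    calc ∫⁻ y, h y ∂haar = ∫⁻ y, h y ^ (1 / 2 : ℝ) * h y ^ (1 / 2 : ℝ) ∂haar := by
          refine lintegral_congr fun y => ?_
          rw [← ENNReal.rpow_add_of_nonneg _ _ (by norm_num) (by norm_num)]
          norm_num
      _ ≤ ∫⁻ y, 2 ^ m * J * h y ^ (1 / 2 : ℝ) ∂haar := by
          refine lintegral_mono fun y => ?_
          gcongr
          exact hsup y
      _ = _ := lintegral_const_mul _ (by fun_prop)
  calc _ ≤ (2 ^ m * J * J) ^ (1 / 2 : ℝ) := by gcongr
    _ = _ := by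
      rw [mul_assoc, ENNReal.mul_rpow_of_nonneg _ _ (by norm_num), ← sq, ← ENNReal.rpow_natCast,
        ← ENNReal.rpow_natCast, ← ENNReal.rpow_mul, ← ENNReal.rpow_mul]
      norm_num
      ring_nf

end Measure

/-! ### Fejér means as convolutions, and their bound by weighted averages -/

section Fejer

variable {𝕜 : Type*} [RCLike 𝕜]

theorem measurable_walsh_dyadicFiltration {i m : ℕ} (h : i < 2 ^ m) :
    Measurable[dyadicFiltration m] (walsh i) := by
  have : walsh i = fun x => ∏ k ∈ Finset.range m, rademacher k x ^ (i.testBit k).toNat :=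
    funext (walsh_eq_prod h)
  rw [this]
  refine @Finset.measurable_prod _ _ _ _ _ _ (dyadicFiltration m) _ _ fun k hk => ?_
  refine Measurable.pow_const ?_ _
  exact (measurable_from_top (f := fun a : ZMod 2 => (-1 : ℝ) ^ a.val)).comp
    (measurable_eval_dyadicFiltration (Finset.mem_range.1 hk))

theorem integrable_walsh_smul {f : G → 𝕜} (hf : Integrable f haar) (i : ℕ) :
    Integrable (walsh i • f) haar :=
  hf.bdd_smul 1 (measurable_walsh i).aestronglyMeasurable
    (.of_forall fun x => (abs_walsh i x).le)

/-- `w_i` is `ζ_m`-measurable, hence can be pulled out of the conditional expectation of `F_n` given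
`ζ_m`. Thus the limit defining a Fourier coefficient is eventually constant. -/
theorem integral_walsh_eq {F : ℕ → G → 𝕜} (hF : Martingale F dyadicFiltration haar)
    {i m n : ℕ} (hi : i < 2 ^ m) (hmn : m ≤ n) :
    ∫ x, F n x * (walsh i x : 𝕜) ∂haar = ∫ x, F m x * (walsh i x : 𝕜) ∂haar := by
  have key (l : ℕ) : ∫ x, F l x * (walsh i x : 𝕜) ∂haar = ∫ x, (walsh i • F l) x ∂haar := by
    refine integral_congr_ae (.of_forall fun x => ?_)
    simp [RCLike.real_smul_eq_coe_mul, mul_comm]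
  rw [key, key, ← integral_condExp (dyadicFiltration.le m)]
  refine integral_congr_ae ?_
  have h1 := condExp_smul_of_aestronglyMeasurable_left (m := dyadicFiltration m) (μ := haar)
    (measurable_walsh_dyadicFiltration hi).stronglyMeasurable.aestronglyMeasurable
    (integrable_walsh_smul (hF.integrable n) i) (hF.integrable n)
  filter_upwards [h1, hF.condExp_ae_eq hmn] with x hx hx'
  rw [hx, Pi.smul_apply', hx', Pi.smul_apply']

theorem fourierCoeff_eq {F : ℕ → G → 𝕜} (hF : Martingale F dyadicFiltration haar)
    {i m : ℕ} (hi : i < 2 ^ m) :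
    fourierCoeff F i = ∫ x, F m x * (walsh i x : 𝕜) ∂haar := by
  refine Tendsto.limUnder_eq (tendsto_const_nhds.congr' ?_)
  filter_upwards [eventually_ge_atTop m] with n hn
  exact (integral_walsh_eq hF hi hn).symm

theorem fejerMean_eq {F : ℕ → G → 𝕜} (hF : Martingale F dyadicFiltration haar)
    {M m : ℕ} (hM : M ≤ 2 ^ m) (x : G) :
    fejerMean F M x =
      (M : 𝕜)⁻¹ * ∫ y, F m y * (fejerSum M (x + y) : 𝕜) ∂haar := by
  have hint (i : ℕ) : Integrable (fun y => F m y * (walsh i (x + y) : 𝕜)) haar := by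
    have := (integrable_walsh_smul (hF.integrable m) i).const_mul (walsh i x : 𝕜)
    refine this.congr (.of_forall fun y => ?_)
    simp only [Pi.smul_apply', RCLike.real_smul_eq_coe_mul, walsh_add]
    push_cast
    ring
  rw [fejerMean]
  congr 1
  simp only [fejerSum, dirichlet, RCLike.ofReal_sum, Finset.mul_sum]
  rw [integral_finsetSum _ fun _ _ => integrable_finsetSum _ fun _ _ => hint _,
    ← Finset.Ico_add_one_right_eq_Icc, Finset.sum_Ico_eq_sum_range]
  refine Finset.sum_congr (by simp) fun l hl => ?_
  rw [integral_finsetSum _ fun _ _ => hint _, partialSum, add_comm 1 l]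
  refine Finset.sum_congr rfl fun i hi => ?_
  simp only [Finset.mem_range] at hl hi
  rw [fourierCoeff_eq hF (m := m) (by omega), ← integral_mul_const]
  refine integral_congr_ae (.of_forall fun y => ?_)
  simp only [walsh_add]
  push_cast
  ring

theorem enorm_fejerMean_le {F : ℕ → G → 𝕜} (hF : Martingale F dyadicFiltration haar)
    {M m : ℕ} (hM : M ≤ 2 ^ m) (x : G) :
    ‖fejerMean F M x‖ₑ ≤
      ∫⁻ y, ‖F m y‖ₑ * ENNReal.ofReal (|fejerSum M (x + y)| / M) ∂haar := by
  rw [fejerMean_eq hF hM, ← integral_const_mul]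
  refine (enorm_integral_le_lintegral_enorm _).trans_eq (lintegral_congr fun y => ?_)
  rw [mul_left_comm, enorm_mul, ← ofReal_norm (_ * _)]
  congr 2
  simp [div_eq_inv_mul]

/-- The average of `d` over the interval `I_j(x + e_t)`. -/
noncomputable def shiftedAverage (j t : ℕ) (d : G → ℝ≥0∞) (x : G) : ℝ≥0∞ :=
  2 ^ j * ∫⁻ y in interval j (x + basisPoint t), d y ∂haar

/-- The ratio `1/√2` of the geometric weights. -/
noncomputable def ratio : ℝ≥0∞ := 2 ^ (-(1 / 2) : ℝ)

/-- The weighted sum `∑_{t ≤ j} 2^{-(j-t)/2} (E_j d)(x + e_t)` of averages. -/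
noncomputable def weightedAverage (j : ℕ) (d : G → ℝ≥0∞) (x : G) : ℝ≥0∞ :=
  ∑ t ∈ Finset.range (j + 1), ratio ^ (j - t) * shiftedAverage j t d x

theorem dependsOnFirst_of_martingale {F : ℕ → G → 𝕜}
    (hF : Martingale F dyadicFiltration haar) (m : ℕ) : DependsOnFirst m (F m) :=
  dependsOnFirst_of_measurable (hF.1 m).measurable

theorem measurable_of_martingale {F : ℕ → G → 𝕜}
    (hF : Martingale F dyadicFiltration haar) (m : ℕ) : Measurable (F m) :=
  (hF.1 m).measurable.mono (dyadicFiltration.le m) le_rfl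

theorem rpow_sum_le_sum_rpow {ι : Type*} (s : Finset ι) (f : ι → ℝ≥0∞) {p : ℝ} (hp : 0 < p)
    (hp1 : p ≤ 1) : (∑ i ∈ s, f i) ^ p ≤ ∑ i ∈ s, f i ^ p :=
  Finset.le_sum_of_subadditive (fun a : ℝ≥0∞ => a ^ p) (ENNReal.zero_rpow_of_pos hp).le
    (fun a b => ENNReal.rpow_add_le_add_rpow a b hp.le hp1) s f

theorem ofReal_kernel_rpow_half_le {s k : ℕ} (h : k ≤ s) (z : G) :
    ENNReal.ofReal (|fejerSum (beta s k) z| / beta s k) ^ (1 / 2 : ℝ) ≤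
      ∑ j ∈ Finset.Icc k s, ∑ t ∈ Finset.range (j + 1),
        2 ^ (((t + j + 1 : ℕ) - s) / 2 : ℝ) * (interval j (basisPoint t)).indicator 1 z := by
  classical
  have hb : (2 : ℝ) ^ s ≤ beta s k := by exact_mod_cast two_pow_le_beta h
  have h1 : |fejerSum (beta s k) z| / beta s k ≤
      ∑ j ∈ Finset.Icc k s, ∑ t ∈ Finset.range (j + 1), 2 ^ (t + j + 1) * bump j t z / 2 ^ s := by
    simp only [← Finset.sum_div]
    exact div_le_div₀ ((abs_nonneg _).trans (abs_fejerSum_beta_le h z))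
      (abs_fejerSum_beta_le h z) (by positivity) hb
  have hnn (j t : ℕ) : 0 ≤ 2 ^ (t + j + 1) * bump j t z / 2 ^ s :=
    div_nonneg (mul_nonneg (by positivity) (bump_nonneg _ _ _)) (by positivity)
  calc _ ≤ (∑ j ∈ Finset.Icc k s, ∑ t ∈ Finset.range (j + 1),
        ENNReal.ofReal (2 ^ (t + j + 1) * bump j t z / 2 ^ s)) ^ (1 / 2 : ℝ) := by
        gcongr
        refine (ENNReal.ofReal_le_ofReal h1).trans_eq ?_
        rw [ENNReal.ofReal_sum_of_nonneg fun _ _ => Finset.sum_nonneg fun _ _ => hnn _ _]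
        exact Finset.sum_congr rfl fun _ _ => ENNReal.ofReal_sum_of_nonneg fun _ _ => hnn _ _
    _ ≤ ∑ j ∈ Finset.Icc k s, ∑ t ∈ Finset.range (j + 1),
        ENNReal.ofReal (2 ^ (t + j + 1) * bump j t z / 2 ^ s) ^ (1 / 2 : ℝ) :=
        (rpow_sum_le_sum_rpow _ _ (by norm_num) (by norm_num)).trans
          (Finset.sum_le_sum fun _ _ => rpow_sum_le_sum_rpow _ _ (by norm_num) (by norm_num))
    _ = _ := by
        refine Finset.sum_congr rfl fun j _ => Finset.sum_congr rfl fun t _ => ?_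
        by_cases hz : z ∈ interval j (basisPoint t)
        · have : (2 : ℝ) ^ (t + j + 1) / 2 ^ s = 2 ^ (((t + j + 1 : ℕ) : ℝ) - s) := by
            rw [Real.rpow_sub two_pos, Real.rpow_natCast, Real.rpow_natCast]
          simp only [bump, Set.indicator_of_mem hz, Pi.one_apply, mul_one, this]
          rw [← ENNReal.ofReal_rpow_of_pos two_pos, ← ENNReal.rpow_mul, ENNReal.ofReal_ofNat]
          ring_nf
        · simp [bump, Set.indicator_of_notMem hz]

theorem enorm_fejerMean_beta_rpow_half_le {F : ℕ → G → 𝕜}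
    (hF : Martingale F dyadicFiltration haar) {s k : ℕ} (h : k ≤ s) (x : G) :
    ‖fejerMean F (beta s k) x‖ₑ ^ (1 / 2 : ℝ) ≤
      2 * ∑ j ∈ Finset.Icc k s,
        weightedAverage j (fun y => ‖F (s + 1) y‖ₑ ^ (1 / 2 : ℝ)) x := by
  have hFd := dependsOnFirst_of_martingale hF (s + 1)
  have hFm := measurable_of_martingale hF (s + 1)
  have hK : Measurable fun y => fejerSum (beta s k) (x + y) :=
    (measurable_fejerSum _).comp (measurable_pi_lambda _ fun i =>
      (measurable_from_top (f := fun a : ZMod 2 => x i + a)).comp (measurable_pi_apply i))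
  set g : G → ℝ≥0∞ := fun y => ‖F (s + 1) y‖ₑ ^ (1 / 2 : ℝ) with hg
  have hgm : Measurable g := by fun_prop
  have hdep : DependsOnFirst (s + 1) fun y => ‖F (s + 1) y‖ₑ *
      ENNReal.ofReal (|fejerSum (beta s k) (x + y)| / beta s k) := by
    intro y z hz
    have h2 : x + z ∈ interval (s + 1) (x + y) := fun j hj => by simp [hz j hj]
    dsimp only
    rw [hFd hz, fejerSum_congr (beta_lt s k).le h2]
  have hmeas : Measurable fun y => ‖F (s + 1) y‖ₑ *
      ENNReal.ofReal (|fejerSum (beta s k) (x + y)| / beta s k) := by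
    have : Measurable fun y => |fejerSum (beta s k) (x + y)| / beta s k :=
      ((continuous_abs.measurable).comp hK).div_const _
    exact hFm.enorm.mul this.ennreal_ofReal
  -- The exponents balance: `(s+1)/2 + (t+j+1-s)/2 = 1 + j - (j-t)/2`. The three terms give the
  -- constant `2`, the normalisation `2^j` of the average, and `ratio ^ (j - t)`.
  have hterm (j t : ℕ) (ht : t ∈ Finset.range (j + 1)) :
      (2 : ℝ≥0∞) ^ ((s + 1 : ℕ) / 2 : ℝ) *
        ∫⁻ y, g y * (2 ^ (((t + j + 1 : ℕ) - s) / 2 : ℝ) *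
          (interval j (basisPoint t)).indicator 1 (x + y)) ∂haar =
      2 * (ratio ^ (j - t) * shiftedAverage j t g x) := by
    have htj : t ≤ j := by simpa [Nat.lt_succ_iff] using ht
    have hind : ∫⁻ y, g y * (2 ^ (((t + j + 1 : ℕ) - s) / 2 : ℝ) *
          (interval j (basisPoint t)).indicator 1 (x + y)) ∂haar =
        2 ^ (((t + j + 1 : ℕ) - s) / 2 : ℝ) *
          ∫⁻ y in interval j (x + basisPoint t), g y ∂haar := by
      rw [← lintegral_indicator (measurableSet_interval _ _), ← lintegral_const_mul _
        (hgm.indicator (measurableSet_interval _ _))]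
      refine lintegral_congr fun y => ?_
      by_cases hy : y ∈ interval j (x + basisPoint t)
      · rw [Set.indicator_of_mem hy, Set.indicator_of_mem ((mem_interval_add_iff _ _ _).2 hy)]
        simp [mul_comm]
      · rw [Set.indicator_of_notMem hy,
          Set.indicator_of_notMem (mt (mem_interval_add_iff _ _ _).1 hy)]
        simp
    rw [hind, shiftedAverage, ratio, ← mul_assoc, ← mul_assoc, ← mul_assoc]
    congr 1
    have h2 : (2 : ℝ≥0∞) = 2 ^ (1 : ℝ) := by simp
    rw [← ENNReal.rpow_natCast, ← ENNReal.rpow_mul, ← ENNReal.rpow_natCast,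
      ← ENNReal.rpow_add _ _ two_ne_zero ENNReal.ofNat_ne_top]
    nth_rewrite 2 [h2]
    rw [← ENNReal.rpow_add _ _ two_ne_zero ENNReal.ofNat_ne_top,
      ← ENNReal.rpow_add _ _ two_ne_zero ENNReal.ofNat_ne_top]
    congr 1
    push_cast [Nat.cast_sub htj]
    ring
  calc _ ≤ (∫⁻ y, ‖F (s + 1) y‖ₑ *
        ENNReal.ofReal (|fejerSum (beta s k) (x + y)| / beta s k) ∂haar) ^ (1 / 2 : ℝ) := by
        gcongr
        exact enorm_fejerMean_le hF (beta_lt s k).le x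
    _ ≤ 2 ^ ((s + 1 : ℕ) / 2 : ℝ) * ∫⁻ y, (‖F (s + 1) y‖ₑ *
        ENNReal.ofReal (|fejerSum (beta s k) (x + y)| / beta s k)) ^ (1 / 2 : ℝ) ∂haar :=
        lintegral_rpow_half_le hdep hmeas
    _ ≤ 2 ^ ((s + 1 : ℕ) / 2 : ℝ) * ∫⁻ y, ∑ j ∈ Finset.Icc k s, ∑ t ∈ Finset.range (j + 1),
          g y * (2 ^ (((t + j + 1 : ℕ) - s) / 2 : ℝ) *
          (interval j (basisPoint t)).indicator 1 (x + y)) ∂haar := by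
        gcongr with y
        rw [ENNReal.mul_rpow_of_nonneg _ _ (by norm_num)]
        simp only [← Finset.mul_sum]
        gcongr
        exact ofReal_kernel_rpow_half_le h _
    _ = _ := by
        have hm (j t : ℕ) : Measurable fun y : G =>
            g y * (2 ^ (((t + j + 1 : ℕ) - s) / 2 : ℝ) *
              (interval j (basisPoint t)).indicator (1 : G → ℝ≥0∞) (x + y)) := by
          refine hgm.mul (Measurable.const_mul ?_ _)
          have : (fun y => (interval j (basisPoint t)).indicator (1 : G → ℝ≥0∞) (x + y)) =
              (interval j (x + basisPoint t)).indicator 1 := by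
            ext y
            classical simp only [Set.indicator_apply, mem_interval_add_iff, Pi.one_apply]
          rw [this]
          exact measurable_one.indicator (measurableSet_interval _ _)
        rw [lintegral_finsetSum _ fun j _ => Finset.measurable_sum _ fun t _ => hm j t,
          Finset.mul_sum, Finset.mul_sum]
        refine Finset.sum_congr rfl fun j _ => ?_
        rw [lintegral_finsetSum _ fun t _ => hm j t, Finset.mul_sum, weightedAverage,
          Finset.mul_sum]
        exact Finset.sum_congr rfl fun t ht => hterm j t ht

end Fejer

/-! ### Integrals of the averages and a majorant uniform in `s` -/

section Averages

theorem measurableSet_mem_interval_add (j t : ℕ) :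
    MeasurableSet {p : G × G | p.2 ∈ interval j (p.1 + basisPoint t)} := by
  have : {p : G × G | p.2 ∈ interval j (p.1 + basisPoint t)} =
      ⋂ i ∈ Finset.range j, (fun p : G × G => (p.1 i, p.2 i)) ⁻¹'
        {q : ZMod 2 × ZMod 2 | q.2 = q.1 + basisPoint t i} := by
    ext p; simp [mem_interval]
  rw [this]
  exact Finset.measurableSet_biInter _ fun i _ =>
    (by fun_prop : Measurable fun p : G × G => (p.1 i, p.2 i)) (Set.toFinite _).measurableSet

theorem shiftedAverage_eq (j t : ℕ) (d : G → ℝ≥0∞) (x : G) :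
    shiftedAverage j t d x = 2 ^ j * ∫⁻ y,
      {p : G × G | p.2 ∈ interval j (p.1 + basisPoint t)}.indicator (fun p => d p.2) (x, y)
        ∂haar := by
  rw [shiftedAverage, ← lintegral_indicator (measurableSet_interval _ _)]
  rfl

theorem measurable_shiftedAverage (j t : ℕ) {d : G → ℝ≥0∞} (hd : Measurable d) :
    Measurable (shiftedAverage j t d) := by
  rw [funext (shiftedAverage_eq j t d)]
  exact (Measurable.lintegral_prod_right'
    ((hd.comp measurable_snd).indicator (measurableSet_mem_interval_add j t))).const_mul _

theorem mem_interval_add_basisPoint_comm {j t : ℕ} {x y : G} :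
    y ∈ interval j (x + basisPoint t) ↔ x ∈ interval j (y + basisPoint t) := by
  rw [← mem_interval_add_iff, add_comm x y, mem_interval_add_iff]

/-- By Tonelli: the relation `y ∈ I_j(x + e_t)` is symmetric in `x` and `y`, and each interval has
measure `2^{-j}`. -/
theorem lintegral_shiftedAverage (j t : ℕ) {d : G → ℝ≥0∞} (hd : Measurable d) :
    ∫⁻ x, shiftedAverage j t d x ∂haar = ∫⁻ x, d x ∂haar := by
  have hm : Measurable ({p : G × G | p.2 ∈ interval j (p.1 + basisPoint t)}.indicator
      fun p => d p.2) := (hd.comp measurable_snd).indicator (measurableSet_mem_interval_add j t)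
  simp only [shiftedAverage_eq]
  rw [lintegral_const_mul _ (Measurable.lintegral_prod_right' hm),
    lintegral_lintegral_swap (f := fun x y => {p : G × G | p.2 ∈ interval j (p.1 +
      basisPoint t)}.indicator (fun p => d p.2) (x, y)) hm.aemeasurable, ← lintegral_const_mul _ hm.lintegral_prod_left']
  refine lintegral_congr fun y => ?_
  have : ∀ x, {p : G × G | p.2 ∈ interval j (p.1 + basisPoint t)}.indicator
      (fun p => d p.2) (x, y) = (interval j (y + basisPoint t)).indicator (fun _ => d y) x := by
    classical
    intro x
    simp only [Set.indicator_apply, Set.mem_ofPred_eq, mem_interval_add_basisPoint_comm (y := y)]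
  simp only [this]
  rw [lintegral_indicator_const (measurableSet_interval _ _), haar_interval, mul_left_comm,
    ← mul_pow, ENNReal.mul_inv_cancel (by simp) (by simp), one_pow, mul_one]

theorem shiftedAverage_of_dependsOnFirst {l j : ℕ} (h : l ≤ j) (t : ℕ) {d : G → ℝ≥0∞}
    (hd : DependsOnFirst l d) (x : G) : shiftedAverage j t d x = d (x + basisPoint t) := by
  rw [shiftedAverage, setLIntegral_congr_fun (measurableSet_interval _ _)
      (fun y hy => hd (interval_anti h _ hy)), setLIntegral_const, haar_interval, mul_left_comm,
    ← mul_pow, ENNReal.mul_inv_cancel (by simp) (by simp), one_pow, mul_one]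

theorem measurable_weightedAverage (j : ℕ) {d : G → ℝ≥0∞} (hd : Measurable d) :
    Measurable (weightedAverage j d) :=
  Finset.measurable_sum _ fun t _ => (measurable_shiftedAverage j t hd).const_mul _

theorem weightedAverage_mono (j : ℕ) {d d' : G → ℝ≥0∞} (h : ∀ x, d x ≤ d' x) (x : G) :
    weightedAverage j d x ≤ weightedAverage j d' x := by
  unfold weightedAverage shiftedAverage
  gcongr
  exact h _

theorem weightedAverage_sum (j : ℕ) {ι : Type*} (s : Finset ι) {d : ι → G → ℝ≥0∞}
    (hd : ∀ i, Measurable (d i)) (x : G) :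
    weightedAverage j (fun y => ∑ i ∈ s, d i y) x = ∑ i ∈ s, weightedAverage j (d i) x := by
  simp only [weightedAverage, shiftedAverage, lintegral_finsetSum _ fun i _ => hd i,
    Finset.mul_sum]
  exact Finset.sum_comm

/-- The sum of the geometric series with ratio `1/√2`. -/
noncomputable def geomConst : ℝ≥0∞ := (1 - ratio)⁻¹

theorem geomConst_ne_top : geomConst ≠ ∞ := by
  have : ratio < 1 := ENNReal.rpow_lt_one_of_one_lt_of_neg (by norm_num) (by norm_num)
  simpa [geomConst, tsub_eq_zero_iff_le] using this

theorem sum_ratio_pow_le (s : Finset ℕ) : ∑ i ∈ s, ratio ^ i ≤ geomConst :=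
  (ENNReal.sum_le_tsum s).trans_eq (ENNReal.tsum_geometric _)

theorem sum_ratio_pow_comp_le (s : Finset ℕ) {f : ℕ → ℕ} (hf : Set.InjOn f s) :
    ∑ i ∈ s, ratio ^ f i ≤ geomConst := by
  rw [← Finset.sum_image (f := fun i => ratio ^ i) hf]
  exact sum_ratio_pow_le _

theorem lintegral_weightedAverage_le (j : ℕ) {d : G → ℝ≥0∞} (hd : Measurable d) :
    ∫⁻ x, weightedAverage j d x ∂haar ≤ geomConst * ∫⁻ x, d x ∂haar := by
  simp only [weightedAverage]
  rw [lintegral_finsetSum _ fun t _ => (measurable_shiftedAverage j t hd).const_mul _]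
  simp only [lintegral_const_mul _ (measurable_shiftedAverage j _ hd),
    lintegral_shiftedAverage j _ hd, ← Finset.sum_mul]
  gcongr
  refine sum_ratio_pow_comp_le _ fun a ha b hb hab => ?_
  simp only [Finset.coe_range, Set.mem_Iio] at *
  omega

/-- Averaging at rank `j ≥ l` only evaluates `d` at `x + e_t`. For `t ≥ l` the shift is invisible to
`d`; for `t < l` the weight splits by `j - t = (j - l) + (l - t)`, reproducing terms of rank `l`. -/
theorem weightedAverage_le_of_dependsOnFirst {l j : ℕ} (h : l ≤ j) {d : G → ℝ≥0∞}
    (hd : DependsOnFirst l d) (x : G) :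
    weightedAverage j d x ≤ geomConst * d x + ratio ^ (j - l) * weightedAverage l d x := by
  rw [weightedAverage, Finset.range_eq_Ico, ← Finset.sum_Ico_consecutive _ (Nat.zero_le l)
    (by omega : l ≤ j + 1), add_comm]
  refine add_le_add ?_ ?_
  · have (t : ℕ) (ht : t ∈ Finset.Ico l (j + 1)) :
        ratio ^ (j - t) * shiftedAverage j t d x = ratio ^ (j - t) * d x := by
      rw [shiftedAverage_of_dependsOnFirst h t hd]
      congr 1
      refine hd fun i hi => ?_
      have := (Finset.mem_Ico.1 ht).1
      simp [basisPoint, Pi.single_eq_of_ne (by omega : i ≠ t)]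
    rw [Finset.sum_congr rfl this, ← Finset.sum_mul]
    gcongr
    refine sum_ratio_pow_comp_le _ fun a ha b hb hab => ?_
    simp only [Finset.coe_Ico, Set.mem_Ico] at *
    omega
  · rw [weightedAverage, Finset.mul_sum, ← Finset.range_eq_Ico]
    refine (Finset.sum_le_sum fun t ht => ?_).trans
      (Finset.sum_le_sum_of_subset (Finset.range_subset_range.2 (Nat.le_succ l)))
    have := Finset.mem_range.1 ht
    rw [shiftedAverage_of_dependsOnFirst h t hd, shiftedAverage_of_dependsOnFirst le_rfl t hd,
      ← mul_assoc, ← pow_add, show j - l + (l - t) = j - t by omega]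

/-- A majorant, independent of `s`, of the averages `ρ(s)⁻¹ ∑_{j=k}^s weightedAverage j d`
for `d` depending on the first `l` coordinates only. -/
noncomputable def majorant (ρ : ℕ → ℕ) (l : ℕ) (d : G → ℝ≥0∞) (x : G) : ℝ≥0∞ :=
  geomConst * d x + geomConst * weightedAverage l d x +
    (ρ (l - 1) : ℝ≥0∞)⁻¹ * ∑ j ∈ Finset.Ico (l - ρ (l - 1)) l, weightedAverage j d x

theorem measurable_majorant (ρ : ℕ → ℕ) (l : ℕ) {d : G → ℝ≥0∞} (hd : Measurable d) :
    Measurable (majorant ρ l d) :=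
  ((hd.const_mul _).add ((measurable_weightedAverage l hd).const_mul _)).add
    ((Finset.measurable_sum _ fun j _ => measurable_weightedAverage j hd).const_mul _)

theorem lintegral_majorant_le (ρ : ℕ → ℕ) (l : ℕ) {d : G → ℝ≥0∞} (hd : Measurable d) :
    ∫⁻ x, majorant ρ l d x ∂haar ≤
      (geomConst + geomConst * geomConst + geomConst) * ∫⁻ x, d x ∂haar := by
  have hw := measurable_weightedAverage l hd
  have hs : Measurable fun x => ∑ j ∈ Finset.Ico (l - ρ (l - 1)) l, weightedAverage j d x :=
    Finset.measurable_sum _ fun j _ => measurable_weightedAverage j hd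
  simp only [majorant]
  rw [lintegral_add_right _ (hs.const_mul _), lintegral_add_right _ (hw.const_mul _),
    lintegral_const_mul _ hd, lintegral_const_mul _ hw, lintegral_const_mul _ hs,
    lintegral_finsetSum _ fun j _ => measurable_weightedAverage j hd, add_mul, add_mul, mul_assoc]
  refine add_le_add (add_le_add le_rfl ?_) ?_
  · gcongr
    exact lintegral_weightedAverage_le l hd
  · calc _ ≤ (ρ (l - 1) : ℝ≥0∞)⁻¹ * ∑ j ∈ Finset.Ico (l - ρ (l - 1)) l,
          geomConst * ∫⁻ x, d x ∂haar := by
          gcongr; exact lintegral_weightedAverage_le _ hd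
      -- The window has at most `ρ (l - 1)` ranks, which the prefactor compensates.
      _ ≤ (ρ (l - 1) : ℝ≥0∞)⁻¹ * (ρ (l - 1) * (geomConst * ∫⁻ x, d x ∂haar)) := by
          rw [Finset.sum_const, nsmul_eq_mul, Nat.card_Ico]
          gcongr
          omega
      _ ≤ _ := by
          rw [← mul_assoc]
          exact mul_le_of_le_one_left' (ENNReal.inv_mul_le_one _)

/-- Split at `j = l`. Above `l`, at most `ρ s` copies of `d x` are normalised by `ρ s`, and the
powers of `ratio` sum to at most `geomConst`. Below `l`, monotonicity of `ρ` controls the prefactor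
and its slow growth confines `j` to a window independent of `s`. -/
theorem inv_mul_sum_weightedAverage_le {ρ : ℕ → ℕ} (hρ0 : ∀ s, ρ s ≠ 0) (hρ : Monotone ρ)
    (hρ1 : ∀ s, ρ (s + 1) ≤ ρ s + 1) {l s k : ℕ} (hl : l ≤ s + 1) (hk : s + 1 ≤ k + ρ s)
    {d : G → ℝ≥0∞} (hd : DependsOnFirst l d) (x : G) :
    (ρ s : ℝ≥0∞)⁻¹ * ∑ j ∈ Finset.Icc k s, weightedAverage j d x ≤ majorant ρ l d x := by
  have hstep : ∀ a b, ρ (a + b) ≤ ρ a + b := by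
    intro a b
    induction b with
    | zero => simp
    | succ b ih => have := hρ1 (a + b); rw [← add_assoc]; omega
  have hinv : (ρ s : ℝ≥0∞)⁻¹ * ρ s = 1 :=
    ENNReal.inv_mul_cancel (by simpa using hρ0 s) (by simp)
  have hinv1 : (ρ s : ℝ≥0∞)⁻¹ ≤ 1 := by
    rw [ENNReal.inv_le_one]
    exact_mod_cast Nat.one_le_iff_ne_zero.2 (hρ0 s)
  rw [← Finset.sum_filter_add_sum_filter_not _ (fun j => l ≤ j), mul_add, majorant]
  refine add_le_add ?_ ?_
  · calc _ ≤ (ρ s : ℝ≥0∞)⁻¹ * ∑ j ∈ (Finset.Icc k s).filter (l ≤ ·),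
          (geomConst * d x + ratio ^ (j - l) * weightedAverage l d x) := by
          gcongr with j hj
          exact weightedAverage_le_of_dependsOnFirst (Finset.mem_filter.1 hj).2 hd x
      _ ≤ (ρ s : ℝ≥0∞)⁻¹ * (ρ s * (geomConst * d x) + geomConst * weightedAverage l d x) := by
          rw [Finset.sum_add_distrib, Finset.sum_const, nsmul_eq_mul, ← Finset.sum_mul]
          gcongr
          · refine (Finset.card_filter_le _ _).trans ?_
            rw [Nat.card_Icc]
            omega
          · refine sum_ratio_pow_comp_le _ fun a ha b hb hab => ?_
            simp only [Finset.coe_filter, Set.mem_ofPred_eq] at *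
            omega
      _ ≤ _ := by
          rw [mul_add, ← mul_assoc, hinv, one_mul]
          exact add_le_add le_rfl (mul_le_of_le_one_left' hinv1)
  · rcases Nat.eq_zero_or_pos l with rfl | hl0
    · simp
    have h1 : ρ (l - 1) ≤ ρ s := hρ (by omega)
    -- Equivalently `l - ρ (l - 1) ≤ s + 1 - ρ s` in the integers, and the right side is at most
    -- `k`.
    have h2 : ρ s ≤ ρ (l - 1) + (s - (l - 1)) := by
      conv_lhs => rw [show s = (l - 1) + (s - (l - 1)) by omega]
      exact hstep _ _
    gcongr
    intro j hj
    simp only [Finset.mem_filter, Finset.mem_Icc, Finset.mem_Ico] at *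
    omega

end Averages

/-! ### Adapted increments of the running maximum -/

section Increments

/-- The increments of the running maximum of a sequence. -/
noncomputable def maxIncrement (f : ℕ → ℝ≥0∞) : ℕ → ℝ≥0∞
  | 0 => f 0
  | l + 1 => partialSups f (l + 1) - partialSups f l

theorem sum_maxIncrement (f : ℕ → ℝ≥0∞) (m : ℕ) :
    ∑ l ∈ Finset.range (m + 1), maxIncrement f l = partialSups f m := by
  induction m with
  | zero => simp [maxIncrement]
  | succ m ih =>
    rw [Finset.sum_range_succ, ih, maxIncrement,
      add_tsub_cancel_of_le ((partialSups f).monotone (Nat.le_succ m))]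

theorem tsum_maxIncrement_le (f : ℕ → ℝ≥0∞) : ∑' l, maxIncrement f l ≤ ⨆ l, f l := by
  refine ENNReal.tsum_le_of_sum_range_le fun m => ?_
  refine (Finset.sum_le_sum_of_subset (Finset.range_subset_range.2 (Nat.le_succ m))).trans ?_
  rw [sum_maxIncrement]
  exact partialSups_le _ _ _ fun i _ => le_iSup f i

theorem measurable_partialSups_apply {f : ℕ → G → ℝ≥0∞} (hf : ∀ l, Measurable (f l)) (m : ℕ) :
    Measurable fun x => partialSups (fun l => f l x) m := by
  induction m with
  | zero => simpa using hf 0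
  | succ m ih => simp only [partialSups_add_one]; exact ih.sup (hf _)

theorem measurable_maxIncrement {f : ℕ → G → ℝ≥0∞} (hf : ∀ l, Measurable (f l)) (l : ℕ) :
    Measurable fun x => maxIncrement (fun l => f l x) l := by
  cases l with
  | zero => exact hf 0
  | succ l =>
    exact (measurable_partialSups_apply hf (l + 1)).sub (measurable_partialSups_apply hf l)

theorem dependsOnFirst_partialSups {f : ℕ → G → ℝ≥0∞} (hf : ∀ l, DependsOnFirst l (f l))
    (m : ℕ) : DependsOnFirst m fun x => partialSups (fun l => f l x) m := by
  induction m with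
  | zero => simpa using hf 0
  | succ m ih =>
    intro x y hxy
    simp only [partialSups_add_one]
    exact congrArg₂ _ (ih.mono (Nat.le_succ m) hxy) (hf (m + 1) hxy)

theorem dependsOnFirst_maxIncrement {f : ℕ → G → ℝ≥0∞} (hf : ∀ l, DependsOnFirst l (f l))
    (l : ℕ) : DependsOnFirst l fun x => maxIncrement (fun l => f l x) l := by
  cases l with
  | zero => exact hf 0
  | succ l =>
    intro x y hxy
    exact congrArg₂ (· - ·) (dependsOnFirst_partialSups hf (l + 1) hxy)
      ((dependsOnFirst_partialSups hf l).mono (Nat.le_succ l) hxy)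

end Increments

/-! ### Comparison of the logarithmic weight with the number of blocks -/

section Weights

theorem rootFloor_mono (n : ℕ) : Monotone (rootFloor n) := fun a b h =>
  Nat.floor_le_floor (Real.rpow_le_rpow (by positivity) (by exact_mod_cast h) (by positivity))

theorem one_div_natCast_le_one {n : ℕ} (hn : 1 ≤ n) : 1 / (n : ℝ) ≤ 1 := by
  rw [div_le_one (by positivity)]
  exact_mod_cast hn

theorem rootFloor_succ_le {n : ℕ} (hn : 1 ≤ n) (s : ℕ) :
    rootFloor n (s + 1) ≤ rootFloor n s + 1 := by
  rw [rootFloor, rootFloor, ← Nat.floor_add_one (by positivity)]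
  refine Nat.floor_le_floor ?_
  have := Real.rpow_add_le_add_rpow (a := s) (b := 1) (p := 1 / n) (by positivity) zero_le_one
    (by positivity) (one_div_natCast_le_one hn)
  simpa using this

/-- Here `6 = 3 · 2`: since `s ≥ 1`, the left side is at most `3 s^{1/n}`; and `log β ≥ s log 2 ≥
s/2` with `(1/2)^{1/n} ≥ 1/2` gives `s^{1/n} ≤ 2 (log β)^{1/n}`. -/
theorem rootFloor_add_two_le {n : ℕ} (hn : 1 ≤ n) {s k : ℕ} (hk : k + 1 ≤ s) :
    (rootFloor n s + 2 : ℝ) ≤ 6 * (Real.log (beta s k) ^ (2 / (n : ℝ))) ^ (1 / 2 : ℝ) := by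
  have hs : (1 : ℝ) ≤ s := by exact_mod_cast (by omega : 1 ≤ s)
  have hn0 : (0 : ℝ) ≤ 1 / n := by positivity
  have hlog : (s : ℝ) * (1 / 2) ≤ Real.log (beta s k) := by
    calc (s : ℝ) * (1 / 2) ≤ s * Real.log 2 := by
          gcongr
          linarith [Real.log_two_gt_d9]
      _ = Real.log (2 ^ s) := (Real.log_pow (x := 2) (n := s)).symm
      _ ≤ _ := Real.log_le_log (by positivity)
        (by exact_mod_cast two_pow_le_beta (by omega : k ≤ s))
  have h0 : 0 ≤ Real.log (beta s k) := le_trans (by positivity) hlog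
  have h1 : (1 : ℝ) ≤ (s : ℝ) ^ (1 / (n : ℝ)) := Real.one_le_rpow hs hn0
  have h2 : (rootFloor n s : ℝ) ≤ (s : ℝ) ^ (1 / (n : ℝ)) := Nat.floor_le (by positivity)
  have h3 : (1 / 2 : ℝ) ≤ (1 / 2 : ℝ) ^ (1 / (n : ℝ)) := by
    simpa using Real.rpow_le_rpow_of_exponent_ge (x := 1 / 2) (by norm_num) (by norm_num)
      (one_div_natCast_le_one hn)
  rw [← Real.rpow_mul h0, show 2 / (n : ℝ) * (1 / 2) = 1 / n by ring]
  have h4 : (s : ℝ) ^ (1 / (n : ℝ)) * (1 / 2) ≤ Real.log (beta s k) ^ (1 / (n : ℝ)) :=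
    calc _ ≤ (s : ℝ) ^ (1 / (n : ℝ)) * (1 / 2) ^ (1 / (n : ℝ)) := by gcongr
      _ = (s * (1 / 2) : ℝ) ^ (1 / (n : ℝ)) := (Real.mul_rpow (by positivity) (by norm_num)).symm
      _ ≤ _ := Real.rpow_le_rpow (by positivity) hlog hn0
  linarith

theorem inv_weight_rpow_half_le {n : ℕ} (hn : 1 ≤ n) {s k : ℕ} (hk : k + 1 ≤ s) :
    (ENNReal.ofReal (Real.log (beta s k : ℝ) ^ (2 / (n : ℝ))))⁻¹ ^ (1 / 2 : ℝ) ≤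
      6 * ((rootFloor n s + 2 : ℕ) : ℝ≥0∞)⁻¹ := by
  have h := ENNReal.ofReal_le_ofReal (rootFloor_add_two_le hn hk)
  have hlog : 0 ≤ Real.log (beta s k : ℝ) := Real.log_natCast_nonneg _
  rw [ENNReal.ofReal_mul (by norm_num), ← ENNReal.ofReal_rpow_of_nonneg (by positivity)
    (by norm_num), ENNReal.ofReal_ofNat,
    show (rootFloor n s + 2 : ℝ) = ((rootFloor n s + 2 : ℕ) : ℝ) by push_cast; rfl,
    ENNReal.ofReal_natCast] at h
  rw [ENNReal.inv_rpow, ENNReal.inv_le_iff_inv_le,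
    ENNReal.mul_inv (.inl (by norm_num)) (.inl (by norm_num)), inv_inv, mul_comm,
    ← div_eq_mul_inv]
  exact ENNReal.div_le_of_le_mul' h

end Weights

/-! ### The maximal operator -/

section Main

variable {𝕜 : Type*} [RCLike 𝕜]

theorem restrictedMaximal_rpow_half_le {n : ℕ} (hn : 1 ≤ n) {F : ℕ → G → 𝕜}
    (hF : Martingale F dyadicFiltration haar) (x : G) :
    restrictedMaximal n F x ^ (1 / 2 : ℝ) ≤ 12 * ∑' l, majorant (fun s => rootFloor n s + 2) l
      (fun y => maxIncrement (fun l => ‖F l y‖ₑ ^ (1 / 2 : ℝ)) l) x := by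
  set d : ℕ → G → ℝ≥0∞ := fun l y => maxIncrement (fun l => ‖F l y‖ₑ ^ (1 / 2 : ℝ)) l with hd
  have hmeas : ∀ l, Measurable (d l) := measurable_maxIncrement fun l =>
    (measurable_of_martingale hF l).enorm.pow_const _
  have hdep : ∀ l, DependsOnFirst l (d l) := dependsOnFirst_maxIncrement fun l =>
    (dependsOnFirst_of_martingale hF l).comp fun a => ‖a‖ₑ ^ (1 / 2 : ℝ)
  -- Squaring exposes the suprema, so that each pair `(s, k)` is treated separately before returning
  -- to square roots.
  rw [one_div, ENNReal.rpow_inv_le_iff two_pos]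
  refine iSup_le fun s => iSup_le fun k => iSup_le fun ⟨hk, hs⟩ => ?_
  rw [← ENNReal.rpow_inv_le_iff two_pos, ← one_div, div_eq_mul_inv,
    ENNReal.mul_rpow_of_nonneg _ _ (by norm_num)]
  calc _ ≤ (2 * ∑ j ∈ Finset.Icc k s,
        weightedAverage j (fun y => ‖F (s + 1) y‖ₑ ^ (1 / 2 : ℝ)) x) *
          (6 * ((rootFloor n s + 2 : ℕ) : ℝ≥0∞)⁻¹) :=
        mul_le_mul' (enorm_fejerMean_beta_rpow_half_le hF (by omega) x)
          (inv_weight_rpow_half_le hn hk)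
    _ = 12 * (((rootFloor n s + 2 : ℕ) : ℝ≥0∞)⁻¹ * ∑ j ∈ Finset.Icc k s,
        weightedAverage j (fun y => ‖F (s + 1) y‖ₑ ^ (1 / 2 : ℝ)) x) := by ring
    _ ≤ 12 * (((rootFloor n s + 2 : ℕ) : ℝ≥0∞)⁻¹ * ∑ j ∈ Finset.Icc k s,
        weightedAverage j (fun y => ∑ l ∈ Finset.range (s + 1 + 1), d l y) x) := by
        gcongr with j
        refine weightedAverage_mono j (fun y => ?_) x
        rw [hd, sum_maxIncrement]
        exact le_partialSups (fun l => ‖F l y‖ₑ ^ (1 / 2 : ℝ)) (s + 1)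
    _ = 12 * ∑ l ∈ Finset.range (s + 1 + 1), ((rootFloor n s + 2 : ℕ) : ℝ≥0∞)⁻¹ *
        ∑ j ∈ Finset.Icc k s, weightedAverage j (d l) x := by
        simp only [weightedAverage_sum _ _ hmeas]
        rw [Finset.sum_comm, Finset.mul_sum]
    _ ≤ 12 * ∑ l ∈ Finset.range (s + 1 + 1), majorant (fun s => rootFloor n s + 2) l (d l) x := by
        gcongr with l hl
        -- The shift by `2` counts the ranks: `s - k + 1 ≤ rootFloor n s + 2`.
        exact inv_mul_sum_weightedAverage_le (ρ := fun s => rootFloor n s + 2) (fun _ => by omega)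
          (fun a b h => by simpa using rootFloor_mono n h)
          (fun s => by have := rootFloor_succ_le hn s; omega)
          (by have := Finset.mem_range.1 hl; omega) (by omega) (hdep l) x
    _ ≤ _ := by
        gcongr
        exact ENNReal.sum_le_tsum _

theorem measurable_restrictedMaximal (n : ℕ) (F : ℕ → G → 𝕜) :
    Measurable (restrictedMaximal n F) := by
  have hw (i : ℕ) : Measurable fun x => (walsh i x : 𝕜) :=
    RCLike.measurable_ofReal.comp (measurable_walsh i)
  have hσ (M : ℕ) : Measurable (fejerMean F M) :=
    (Finset.measurable_sum _ fun _ _ => Finset.measurable_sum _ fun i _ =>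
      (hw i).const_mul _).const_mul _
  exact .iSup fun s => .iSup fun k => .iSup fun _ => (hσ _).enorm.div_const _

/-- The constant in the estimate of `∫ (restrictedMaximal n F) ^ (1 / 2)`. -/
noncomputable def maximalConst : ℝ≥0∞ :=
  12 * (geomConst + geomConst * geomConst + geomConst)

theorem maximalConst_ne_top : maximalConst ≠ ∞ := by
  have := geomConst_ne_top
  unfold maximalConst
  finiteness

theorem lintegral_restrictedMaximal_rpow_half_le {n : ℕ} (hn : 1 ≤ n) {F : ℕ → G → 𝕜}
    (hF : Martingale F dyadicFiltration haar) :
    ∫⁻ x, restrictedMaximal n F x ^ (1 / 2 : ℝ) ∂haar ≤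
      maximalConst * ∫⁻ x, maximalFunction F x ^ (1 / 2 : ℝ) ∂haar := by
  have hmeas : ∀ l, Measurable fun y => maxIncrement (fun l => ‖F l y‖ₑ ^ (1 / 2 : ℝ)) l :=
    measurable_maxIncrement fun l => (measurable_of_martingale hF l).enorm.pow_const _
  have hmaj l := measurable_majorant (fun s => rootFloor n s + 2) l (hmeas l)
  refine (lintegral_mono (restrictedMaximal_rpow_half_le hn hF)).trans ?_
  rw [lintegral_const_mul _ (Measurable.tsum hmaj), maximalConst, mul_assoc]
  gcongr
  rw [lintegral_tsum fun l => (hmaj l).aemeasurable]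
  -- Summation over `l` costs nothing: the increments are nonnegative and telescope to at most
  -- `sup_l |F_l|^{1/2}`.
  refine (ENNReal.tsum_le_tsum fun l => lintegral_majorant_le _ l (hmeas l)).trans ?_
  rw [ENNReal.tsum_mul_left, ← lintegral_tsum fun l => (hmeas l).aemeasurable]
  gcongr with x
  refine (tsum_maxIncrement_le _).trans (iSup_le fun l => ?_)
  gcongr
  exact le_iSup (fun l => ‖F l x‖ₑ) l

theorem eLpNorm_half_eq (f : G → ℝ≥0∞) :
    eLpNorm f (1 / 2) haar = (∫⁻ x, f x ^ (1 / 2 : ℝ) ∂haar) ^ (2 : ℝ) := by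
  rw [eLpNorm_eq_lintegral_rpow_enorm_toReal (by simp) (by simp)]
  simp

end Main

end WalshFejer

theorem corollary6 {𝕜 : Type*} [RCLike 𝕜] (n : ℕ) (hn : 1 ≤ n) :
    ∃ C : ℝ≥0, ∀ F : ℕ → WalshFejer.G → 𝕜, WalshFejer.MemHardy (1 / 2) F →
      MemLp (WalshFejer.restrictedMaximal n F) (1 / 2) WalshFejer.haar ∧
        eLpNorm (WalshFejer.restrictedMaximal n F) (1 / 2) WalshFejer.haar ≤
          C * WalshFejer.hardyNorm (1 / 2) F := by
  have hC : WalshFejer.maximalConst ^ (2 : ℝ) ≠ ∞ :=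
    ENNReal.rpow_ne_top_of_nonneg (by norm_num) WalshFejer.maximalConst_ne_top
  -- The `L_{1/2}` quasi-norm is the square of the integral of the square root, so the constant is
  -- squared; it does not depend on `n`.
  refine ⟨(WalshFejer.maximalConst ^ (2 : ℝ)).toNNReal, fun F hF => ?_⟩
  have key : eLpNorm (WalshFejer.restrictedMaximal n F) (1 / 2) WalshFejer.haar ≤
      (WalshFejer.maximalConst ^ (2 : ℝ)).toNNReal * WalshFejer.hardyNorm (1 / 2) F := by
    rw [ENNReal.coe_toNNReal hC, WalshFejer.hardyNorm, WalshFejer.eLpNorm_half_eq,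
      WalshFejer.eLpNorm_half_eq, ← ENNReal.mul_rpow_of_nonneg _ _ (by norm_num)]
    gcongr
    exact WalshFejer.lintegral_restrictedMaximal_rpow_half_le hn hF.1
  exact ⟨⟨(WalshFejer.measurable_restrictedMaximal n F).aestronglyMeasurable,
    key.trans_lt (ENNReal.mul_lt_top ENNReal.coe_lt_top hF.2)⟩, key⟩
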